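/- Let $\widetilde\Sigma=\langle(\Sigma_c^1,\Sigma_r^1),(\Sigma_c^2,\Sigma_r^2),\Sigma_{\mathit{int}}\rangle$ consist of five pairwise disjoint finite sets (calls and returns of stack $s=1,2$, and internal actions), and let $\Sigma$ be their union and $\Sigma_r=\Sigma_r^1\cup\Sigma_r^2$. A string over $\Sigma$ is $s$-well formed if it is generated by the grammar $X::=aXb\mid XX\mid\varepsilon\mid c$ with $a\in\Sigma_c^s$, $b\in\Sigma_r^s$, $c\in\Sigma\setminus(\Sigma_c^s\cup\Sigma_r^s)$. A nested word is a structure $W=([n],\lessdot,\mu,\lambda)$ with $[n]=\{1,\dots,n\}$, $n\ge 1$, $\lambda:[n]\to\Sigma$, $\lessdot=\{(i,i+1)\mid 1\le i<n\}$ and $\mu=\mu^1\cup\mu^2$, where $(i,j)\in\mu^s$ iff $i<j$, $\lambda(i)\in\Sigma_c^s$, $\lambda(j)\in\Sigma_r^s$ and $\lambda(i+1)\cdots\lambda(j-1)$ is $s$-well formed. The relations $\mu$ and $\mu^{-1}$ are partial maps. Let $\mathbb{NW}(\widetilde\Sigma)$ be the set of nested words. For $r\in\mathbb N$, the $r$-sphere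 $r\text{-}\mathrm{Sph}(W,i)$ is the substructure of $W$ induced on the nodes at distance at most $r$ from $i$ in the undirected graph with edges $\lessdot\cup\mu$, together with $i$ as a distinguished constant. Let $\mathit{Spheres}_r(\widetilde\Sigma)$ be the set of (isomorphism types of) $r$-spheres of nodes of nested words. A generalized 2-stack nested-word automaton over $\widetilde\Sigma$ is a tuple $\mathcal B=(Q,\delta,Q_I,F,C)$ with $Q$ a finite set, $Q_I,F,C\subseteq Q$ (initial, final, calling states) and $\delta=\langle\delta_1,\delta_2\rangle$, $\delta_1\subseteq Q\times\Sigma\times Q$, $\delta_2\subseteq Q\times Q\times\Sigma_r\times Q$. A run of $\mathcal B$ on $W$ is a map $\rho:[n]\to Q$ such that $(q,\lambda(1),\rho(1))\in\delta_1$ for some $q\in Q_I$ and, for every $i\in\{2,\dots,n\}$, $(\rho(\mu^{-1}(i)),\rho(i-1),\lambda(i),\rho(i))\in\delta_2$ if $\mu^{-1}(i)$ is defined, and $(\rho(i-1),\lambda(i),\rho(i))\in\delta_1$ otherwise. The run is accepting if $\rho(n)\in F$ and $\mu(i)$ is defined for every $i$ with $\rho(i)\in C$. Let $\mathcal L(\mathcal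 B)$ be the set of nested words that admit an accepting run. **Proposition.** For every $r\in\mathbb N$ there are a generalized 2-stack nested-word automaton $\mathcal B_r=(Q,\delta,Q_I,F,C)$ over $\widetilde\Sigma$ and a mapping $\eta:Q\to\mathit{Spheres}_r(\widetilde\Sigma)$ such that - $\mathcal L(\mathcal B_r)=\mathbb{NW}(\widetilde\Sigma)$, and - for every nested word $W\in\mathbb{NW}(\widetilde\Sigma)$, every accepting run $\rho$ of $\mathcal B_r$ on $W$ and every node $i$ of $W$, we have $\eta(\rho(i))\cong r\text{-}\mathrm{Sph}(W,i)$. -/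

import Mathlib

/-- The role of a letter over `K` stacks: a call of stack `s`, a return of stack `s`,
or an internal action. -/
inductive ActionKind (K : ℕ) where
  | call (s : Fin K)
  | ret (s : Fin K)
  | internal

/-- A `K`-stack call-return alphabet with set of letters `A`.  A collection of pairwise disjoint
sets `Σ_c^s`, `Σ_r^s` (for each stack `s`) and `Σ_int` with union `A` is the same thing as a map
sending each letter to the one set that contains it.  Finiteness of `A` is assumed where the
alphabet is used. -/
structure CallReturnAlphabet (K : ℕ) (A : Type*) where
  kind : A → ActionKind K

namespace CallReturnAlphabet

variable {K : ℕ} {A : Type*} (S : CallReturnAlphabet K A)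

/-- The letters `Σ_c^s` that call stack `s`. -/
def calls (s : Fin K) : Set A := {a | S.kind a = ActionKind.call s}

/-- The letters `Σ_r^s` that return from stack `s`. -/
def returns (s : Fin K) : Set A := {a | S.kind a = ActionKind.ret s}

/-- The set `Σ_r` of all return letters. -/
def allReturns : Set A := ⋃ s, S.returns s

/-- The `s`-well formed strings, generated by the grammar `X ::= a X b | X X | ε | c` with
`a ∈ Σ_c^s`, `b ∈ Σ_r^s` and `c` in neither of these two sets. -/
inductive WellFormed (s : Fin K) : List A → Prop
  | wrap {a b : A} {w : List A} (ha : a ∈ S.calls s) (hb : b ∈ S.returns s)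
      (hw : WellFormed s w) : WellFormed s (a :: (w ++ [b]))
  | append {v w : List A} (hv : WellFormed s v) (hw : WellFormed s w) : WellFormed s (v ++ w)
  | nil : WellFormed s []
  | single {c : A} (h₁ : c ∉ S.calls s) (h₂ : c ∉ S.returns s) : WellFormed s [c]

end CallReturnAlphabet

/-- A finite nested word, given by its length `n ≥ 1` and its labelling; positions are
`0, …, n - 1`.  The edge relations are determined by these data, see `NestedWord.succ` and
`NestedWord.mu`. -/
structure NestedWord {K : ℕ} {A : Type*} (S : CallReturnAlphabet K A) where
  length : ℕ
  length_pos : 0 < length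
  label : Fin length → A

namespace NestedWord

variable {K : ℕ} {A : Type*} {S : CallReturnAlphabet K A} (W : NestedWord S)

/-- The nodes (positions) of the nested word. -/
abbrev Node : Type := Fin W.length

/-- The first position. -/
def first : W.Node := ⟨0, W.length_pos⟩

/-- The last position. -/
def last : W.Node := ⟨W.length - 1, Nat.sub_lt W.length_pos Nat.one_pos⟩

/-- The direct successor relation on positions. -/
def succ (i j : W.Node) : Prop := i.val + 1 = j.val

/-- The string of labels strictly between positions `i` and `j`. -/
def between (i j : W.Node) : List A :=
  ((List.ofFn W.label).drop (i.val + 1)).take (j.val - (i.val + 1))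

/-- The matching relation of stack `s`. -/
def muStack (s : Fin K) (i j : W.Node) : Prop :=
  i < j ∧ W.label i ∈ S.calls s ∧ W.label j ∈ S.returns s ∧ S.WellFormed s (W.between i j)

/-- The matching relation, the union over all stacks. -/
def mu (i j : W.Node) : Prop := ∃ s, W.muStack s i j

end NestedWord

/-- A structure with two binary relations and a labelling of its universe by `A`. -/
structure LabelledStructure (A : Type*) where
  Carrier : Type
  succ : Carrier → Carrier → Prop
  mu : Carrier → Carrier → Prop
  label : Carrier → A

/-- A labelled structure with a distinguished element (for spheres, the sphere center). -/
structure PointedStructure (A : Type*) extends LabelledStructure A where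
  center : Carrier

/-- Isomorphisms of pointed labelled structures. -/
structure PointedStructure.Iso {A : Type*} (M N : PointedStructure A) where
  toEquiv : M.Carrier ≃ N.Carrier
  map_succ : ∀ x y, N.succ (toEquiv x) (toEquiv y) ↔ M.succ x y
  map_mu : ∀ x y, N.mu (toEquiv x) (toEquiv y) ↔ M.mu x y
  map_label : ∀ x, N.label (toEquiv x) = M.label x
  map_center : toEquiv M.center = N.center

namespace LabelledStructure

variable {A : Type*} (M : LabelledStructure A)

/-- The Gaifman graph: two distinct elements are adjacent iff they are related, in one of the two
directions, by one of the two binary relations. -/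
def gaifman : SimpleGraph M.Carrier := SimpleGraph.fromRel fun x y => M.succ x y ∨ M.mu x y

/-- The `r`-sphere around `i`: the substructure induced on the elements at distance at most `r`
from `i` in the Gaifman graph (`edist` is infinite between unconnected elements), with center
`i`. -/
def sphere (r : ℕ) (i : M.Carrier) : PointedStructure A where
  Carrier := {j : M.Carrier // M.gaifman.edist i j ≤ (r : ℕ∞)}
  succ x y := M.succ x.1 y.1
  mu x y := M.mu x.1 y.1
  label x := M.label x.1
  center := ⟨i, by simp⟩

end LabelledStructure

/-- The nested word as a labelled structure. -/
def NestedWord.toStructure {K : ℕ} {A : Type*} {S : CallReturnAlphabet K A} (W : NestedWord S) :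
    LabelledStructure A where
  Carrier := W.Node
  succ := W.succ
  mu := W.mu
  label := W.label

/-- The `r`-sphere of the nested word `W` around the node `i`. -/
def NestedWord.sphere {K : ℕ} {A : Type*} {S : CallReturnAlphabet K A} (W : NestedWord S)
    (r : ℕ) (i : W.Node) : PointedStructure A :=
  W.toStructure.sphere r i

/-- The `r`-spheres that arise, up to isomorphism, from nested words over the alphabet. -/
def CallReturnAlphabet.Spheres {K : ℕ} {A : Type*} (S : CallReturnAlphabet K A) (r : ℕ) :
    Set (PointedStructure A) :=
  {T | ∃ (W : NestedWord S) (i : W.Node), Nonempty (T.Iso (W.sphere r i))}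

/-- A generalized multi-stack nested-word automaton. -/
structure GeneralizedMNWA {K : ℕ} {A : Type*} (S : CallReturnAlphabet K A) where
  State : Type
  finite_state : Finite State
  /-- local and push transitions, and transitions at unmatched returns -/
  δ₁ : Set (State × A × State)
  /-- transitions at matched returns; the first component is the state at the matching call -/
  δ₂ : Set (State × State × A × State)
  δ₂_returns : ∀ p q a q', (p, q, a, q') ∈ δ₂ → a ∈ S.allReturns
  initial : Set State
  final : Set State
  calling : Set State

namespace GeneralizedMNWA

variable {K : ℕ} {A : Type*} {S : CallReturnAlphabet K A} (B : GeneralizedMNWA S)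

/-- `ρ` is a run of `B` on `W`. Every position has at most one matching call. -/
def IsRun (W : NestedWord S) (ρ : W.Node → B.State) : Prop :=
  (∃ q ∈ B.initial, (q, W.label W.first, ρ W.first) ∈ B.δ₁) ∧
  ∀ i j, W.succ i j →
    (∀ c, W.mu c j → (ρ c, ρ i, W.label j, ρ j) ∈ B.δ₂) ∧
    ((¬ ∃ c, W.mu c j) → (ρ i, W.label j, ρ j) ∈ B.δ₁)

/-- `ρ` is an accepting run of `B` on `W`: it ends in a final state, and calling states occur only
at matched calls. -/
def IsAcceptingRun (W : NestedWord S) (ρ : W.Node → B.State) : Prop :=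
  B.IsRun W ρ ∧ ρ W.last ∈ B.final ∧ ∀ i, ρ i ∈ B.calling → ∃ j, W.mu i j

/-- The set of nested words that allow for an accepting run. -/
def language : Set (NestedWord S) := {W | ∃ ρ : W.Node → B.State, B.IsAcceptingRun W ρ}

end GeneralizedMNWA

/-!
The automaton guesses, at every node `j`, the spheres around all nodes near `j` together with the
position of `j` in each of them.  The spheres are told apart by a colouring of the nodes that
distinguishes nearby ones.  Bounded degree makes the numbers of colours and of isomorphism types of
spheres finite (`NestedWord.exists_coloring`, `CallReturnAlphabet.exists_sphere_representatives`).
Transitions, calling states and final states check that the guesses agree along every edge and that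
every edge present in a guess exists; `SphereFamily.isAcceptingRun_iff` says that an accepting run
is just such a consistent labelling.  The true data form one (`SphereFamily.exists_isConsistent`),
so every nested word is accepted.

Conversely, in a consistent labelling the nodes that carry a position in a fixed sphere `M` under a
fixed colour form a partial covering of `M` (`IsPartialCover`): edges of `M` lift uniquely, but a
priori a cycle of `M` may lift to a walk that is not closed, so that the labelled nodes unroll the
cycle.  That this does not happen is the heart of the matter, and it depends on there being only two
stacks.  A nested word over two stacks is drawn in the plane without crossings, with the positions
on a line and the matching edges as semicircles above the line for one stack and below it for the
other.  As the word is finite, the lift of a simple cycle, continued forever, closes up after `k`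
rounds to a simple closed curve.  By Hopf's Umlaufsatz (`IsArchWalk.sum_turning`) that curve makes
exactly one full turn.  The turning is a sum of contributions that depend only on the kinds of
consecutive edges, so it is `k` times the turning of one round, which is a whole number of full
turns.  Hence `k = 1` (`IsArchWalk.eq_one_of_periodic`, `IsPartialCover.lift_closed`), every
component of the partial covering is mapped injectively (`IsPartialCover.eq_of_reachable`), and the
component of a node labelled by the center is its sphere
(`NestedWord.nonempty_iso_of_isPartialCover`).
-/

/-! ### Turning numbers of curves made of segments and semicircles -/

/-- A walk `v` on the integer points of a horizontal line in the plane.  The step from `v t` to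
`v (t + 1)` goes in direction `d t = ±1`.  It is a unit segment of the line if `c t = 0`, and a
semicircle above (`c t = 1`) or below (`c t = -1`) the line otherwise.  Two semicircles are never
consecutive, and two semicircles on the same side of the line do not cross. -/
structure IsArchWalk (v d c : ℕ → ℤ) : Prop where
  advance : ∀ t, (d t = 1 ∧ v t < v (t + 1)) ∨ (d t = -1 ∧ v (t + 1) < v t)
  side : ∀ t, c t = 0 ∨ c t = 1 ∨ c t = -1
  line : ∀ t, c t = 0 → v (t + 1) = v t + d t
  alternate : ∀ t, c t = 0 ∨ c (t + 1) = 0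
  noncross : ∀ s t, c s = c t → c s ≠ 0 → min (v s) (v (s + 1)) < min (v t) (v (t + 1)) →
    min (v t) (v (t + 1)) < max (v s) (v (s + 1)) →
    max (v t) (v (t + 1)) ≤ max (v s) (v (s + 1))

/-- The change, in clockwise half turns, of the direction from the point `p` to a point that
performs step `t` of the walk.  Reversing the roles of the fixed and the moving point gives the
same change. -/
def sweep (v d c : ℕ → ℤ) (t : ℕ) (p : ℤ) : ℤ :=
  if (v t < p ∧ p < v (t + 1)) ∨ (v (t + 1) < p ∧ p < v t) then d t * c t else 0

/-- The change of direction, in clockwise half turns, from the midpoint of step `t` of a walk to the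
midpoint of step `t + 1`. -/
def turning (d c : ℕ → ℤ) (t : ℕ) : ℤ :=
  if d t = d (t + 1) then 0 else d t * c t + d (t + 1) * c (t + 1)

theorem mem_iff_mem_of_noncrossing {a b e f : ℤ} (h₁ : a ≠ f) (h₂ : a ≠ e) (h₃ : b ≠ f)
    (h₄ : b ≠ e) (n₁ : min a b < min f e → min f e < max a b → max f e ≤ max a b)
    (n₂ : min f e < min a b → min a b < max f e → max a b ≤ max f e) :
    (f < b ∧ b < e) ∨ (e < b ∧ b < f) ↔ (f < a ∧ a < e) ∨ (e < a ∧ a < f) := by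
  grind

/-- Two semicircles on opposite sides of the line sweep over each other's ends by equal amounts. -/
theorem sweep_opposite {a b e f x ds dt : ℤ} (h₁ : a ≠ f) (h₂ : a ≠ e) (h₃ : b ≠ f) (h₄ : b ≠ e)
    (as : ds = 1 ∧ a < b ∨ ds = -1 ∧ b < a) (at' : dt = 1 ∧ f < e ∨ dt = -1 ∧ e < f) :
    (if (f < b ∧ b < e) ∨ (e < b ∧ b < f) then dt * x else 0) -
        (if (f < a ∧ a < e) ∨ (e < a ∧ a < f) then dt * x else 0) =
      (if (a < e ∧ e < b) ∨ (b < e ∧ e < a) then ds * -x else 0) -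
        (if (a < f ∧ f < b) ∨ (b < f ∧ f < a) then ds * -x else 0) := by
  rcases h₁.lt_or_gt with h₁ | h₁ <;> rcases h₂.lt_or_gt with h₂ | h₂ <;>
  rcases h₃.lt_or_gt with h₃ | h₃ <;> rcases h₄.lt_or_gt with h₄ | h₄ <;>
  rcases as with ⟨ds, as⟩ | ⟨ds, as⟩ <;> rcases at' with ⟨dt, at'⟩ | ⟨dt, at'⟩ <;>
  first
  | omega
  | (simp only [h₁, h₂, h₃, h₄, h₁.not_gt, h₂.not_gt, h₃.not_gt, h₄.not_gt, ds, dt]; simp)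

namespace IsArchWalk

variable {v d c : ℕ → ℤ}

/-- Moving the two ends of a secant along two disjoint steps turns it by the same amount in either
order.  For two semicircles this is where planarity enters. -/
theorem sweep_sub_sweep (h : IsArchWalk v d c) {s t : ℕ} (h₁ : v s ≠ v t) (h₂ : v s ≠ v (t + 1))
    (h₃ : v (s + 1) ≠ v t) (h₄ : v (s + 1) ≠ v (t + 1)) :
    sweep v d c t (v (s + 1)) - sweep v d c t (v s) =
      sweep v d c s (v (t + 1)) - sweep v d c s (v t) := by
  have as := h.advance s
  have at' := h.advance t
  have ls := h.line s
  have lt := h.line t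
  unfold sweep
  by_cases cs : c s = 0
  · have e := ls cs
    rw [cs, mul_zero, ite_self, ite_self, sub_self, sub_eq_zero]
    refine if_congr ?_ rfl rfl
    omega
  by_cases ct : c t = 0
  · have e := lt ct
    rw [ct, mul_zero, ite_self, ite_self, sub_self, eq_comm, sub_eq_zero]
    refine if_congr ?_ rfl rfl
    omega
  by_cases cst : c s = c t
  · have n₁ := h.noncross s t cst cs
    have n₂ := h.noncross t s cst.symm ct
    rw [if_congr (mem_iff_mem_of_noncrossing h₁ h₂ h₃ h₄ n₁ n₂) rfl rfl,
      if_congr (mem_iff_mem_of_noncrossing h₁.symm h₃.symm h₂.symm h₄.symm n₂ n₁) rfl rfl,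
      sub_self, sub_self]
  · have hc : c s = -c t := by have := h.side s; have := h.side t; omega
    rw [hc]
    exact sweep_opposite h₁ h₂ h₃ h₄ as at'

/-- The turning at a vertex, expressed by moving the two ends of a secant one after the other. -/
theorem sweep_add_sweep (h : IsArchWalk v d c) {s : ℕ} (h₁ : v s ≠ v (s + 2)) :
    sweep v d c (s + 1) (v s) + sweep v d c s (v (s + 2)) = turning d c s := by
  have as := h.advance s
  have at' := h.advance (s + 1)
  have ls := h.line s
  have lt := h.line (s + 1)
  unfold sweep turning
  rw [show s + 1 + 1 = s + 2 from rfl] at *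
  rcases h.alternate s with hc | hc
  · have e := ls hc
    rcases as with ⟨ds, as⟩ | ⟨ds, as⟩ <;> rcases at' with ⟨dt, at'⟩ | ⟨dt, at'⟩ <;>
    rw [hc, ds, dt] <;> simp only [mul_zero, ite_self] <;> norm_num <;> omega
  · have e := lt hc
    rcases as with ⟨ds, as⟩ | ⟨ds, as⟩ <;> rcases at' with ⟨dt, at'⟩ | ⟨dt, at'⟩ <;>
    rw [hc, ds, dt] <;> simp only [mul_zero, ite_self] <;> norm_num <;> omega

/-- **Hopf's Umlaufsatz** for arch walks: a simple closed arch walk, started at its leftmost point,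
makes one full turn.  The secant from `v s` to `v t` is moved over the triangle `s < t`: along the
diagonal it performs the turns of the curve, along the two legs one of its ends is the leftmost
point. -/
theorem sum_turning (h : IsArchWalk v d c) {n : ℕ} (hper : ∀ t, v (t + (n + 3)) = v t)
    (hd : ∀ t, d (t + (n + 3)) = d t) (hc : ∀ t, c (t + (n + 3)) = c t)
    (hinj : ∀ s t, s < n + 3 → t < n + 3 → v s = v t → s = t) (hmin : ∀ t, v 0 ≤ v t) :
    ∑ t ∈ Finset.range (n + 3), turning d c t = 2 ∨
      ∑ t ∈ Finset.range (n + 3), turning d c t = -2 := by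
  have hne : ∀ s t, s < n + 3 → t < n + 3 → s ≠ t → v s ≠ v t :=
    fun s t hs ht hst e => hst (hinj s t hs ht e)
  have hzero : ∀ t, sweep v d c t (v 0) = 0 := by
    intro t
    have h₁ := hmin t
    have h₂ := hmin (t + 1)
    unfold sweep
    rw [if_neg (by omega)]
  have h0 : v (n + 3) = v 0 := by simpa using hper 0
  have h1 : v (n + 4) = v 1 := by simpa [add_comm, add_left_comm] using hper 1
  -- The turns along the diagonal, compared with moving the tail of the secant along `v 0, …, v k`
  -- while its head stays at `v (k + 1)`.
  have htri : ∀ k, k ≤ n + 1 → ∑ s ∈ Finset.range k, turning d c s =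
      ∑ s ∈ Finset.range k, sweep v d c s (v (k + 1)) := by
    intro k
    induction k with
    | zero => intro _; simp
    | succ k ih =>
      intro hk
      rw [Finset.sum_range_succ, ih (by omega), Finset.sum_range_succ,
        ← h.sweep_add_sweep (hne k (k + 2) (by omega) (by omega) (by omega))]
      have e : ∑ s ∈ Finset.range k, (sweep v d c s (v (k + 1 + 1)) - sweep v d c s (v (k + 1))) =
          ∑ s ∈ Finset.range k,
            (sweep v d c (k + 1) (v (s + 1)) - sweep v d c (k + 1) (v s)) := by
        refine Finset.sum_congr rfl fun s hs => ?_
        have := Finset.mem_range.mp hs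
        exact (h.sweep_sub_sweep (hne _ _ (by omega) (by omega) (by omega))
          (hne _ _ (by omega) (by omega) (by omega)) (hne _ _ (by omega) (by omega) (by omega))
          (hne _ _ (by omega) (by omega) (by omega))).symm
      rw [Finset.sum_range_sub (fun s => sweep v d c (k + 1) (v s)), Finset.sum_sub_distrib, hzero]
        at e
      rw [show k + 2 = k + 1 + 1 from rfl]
      linarith
  -- The last leg of the triangle, on which the step from `v (n + 2)` back to `v 0` moves the head.
  have hleg : ∑ s ∈ Finset.range n, (-sweep v d c (s + 1) (v (n + 2))) =
      ∑ s ∈ Finset.range n,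
        (sweep v d c (n + 2) (v (s + 1 + 1)) - sweep v d c (n + 2) (v (s + 1))) := by
    refine Finset.sum_congr rfl fun s hs => ?_
    have := Finset.mem_range.mp hs
    rw [h.sweep_sub_sweep (hne _ _ (by omega) (by omega) (by omega))
      (by rw [show n + 2 + 1 = n + 3 from rfl, h0]; exact hne _ _ (by omega) (by omega) (by omega))
      (hne _ _ (by omega) (by omega) (by omega))
      (by rw [show n + 2 + 1 = n + 3 from rfl, h0]; exact hne _ _ (by omega) (by omega) (by omega)),
      show n + 2 + 1 = n + 3 from rfl, h0, hzero, zero_sub]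
  rw [Finset.sum_range_sub (fun s => sweep v d c (n + 2) (v (s + 1))), Finset.sum_neg_distrib]
    at hleg
  have t₁ := h.sweep_add_sweep (s := n + 1)
    (by rw [show n + 1 + 2 = n + 3 from rfl, h0]; exact hne _ _ (by omega) (by omega) (by omega))
  have t₂ := h.sweep_add_sweep (s := n + 2)
    (by rw [show n + 2 + 2 = n + 4 from rfl, h1]; exact hne _ _ (by omega) (by omega) (by omega))
  have hs0 : sweep v d c (n + 3) (v (n + 2)) = sweep v d c 0 (v (n + 2)) := by
    have e1 := hd 0
    have e2 := hc 0
    simp only [zero_add] at e1 e2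
    simp only [sweep, h0, e1, e2, show n + 3 + 1 = n + 4 from rfl, h1, zero_add]
  rw [show n + 1 + 2 = n + 3 from rfl, h0, hzero, show n + 1 + 1 = n + 2 from rfl] at t₁
  rw [show n + 2 + 2 = n + 4 from rfl, h1, show n + 2 + 1 = n + 3 from rfl, hs0] at t₂
  rw [Finset.sum_range_succ, Finset.sum_range_succ, htri (n + 1) le_rfl, Finset.sum_range_succ',
    ← t₁, ← t₂]
  rw [show n + 1 + 1 = n + 2 from rfl]
  simp only [zero_add] at hleg
  -- At the leftmost point one of the two steps is a unit segment, below or above which the other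
  -- one, a semicircle, passes.
  have key : sweep v d c 0 (v (n + 2)) + sweep v d c (n + 2) (v 1) = 1 ∨
      sweep v d c 0 (v (n + 2)) + sweep v d c (n + 2) (v 1) = -1 := by
    have a0 := h.advance 0
    have a1 := h.advance (n + 2)
    have l0 := h.line 0
    have l1 := h.line (n + 2)
    have al := h.alternate (n + 2)
    have c0 := h.side 0
    have c1 := h.side (n + 2)
    have e2 := hc 0
    have hne1 : v 1 ≠ v (n + 2) := hne _ _ (by omega) (by omega) (by omega)
    have m1 := hmin 1
    have m2 := hmin (n + 2)
    rw [zero_add] at e2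
    unfold sweep
    simp only [zero_add, show n + 2 + 1 = n + 3 from rfl, h0, e2] at *
    have d0 : d 0 = 1 := by omega
    have d1 : d (n + 2) = -1 := by omega
    rw [d0, d1] at *
    rcases al with al | al <;> rw [al] <;> split_ifs <;> omega
  rcases key with key | key
  · left; linarith
  · right; linarith

/-- The sum of the turnings over a closed sequence of directions is even. -/
theorem even_sum_turning (h : IsArchWalk v d c) (hv : ∀ t, v t ≠ v (t + 2)) {m : ℕ}
    (hd : d m = d 0) :
    Even (∑ t ∈ Finset.range m, turning d c t) := by
  have key : ∀ k, Even (∑ t ∈ Finset.range k, turning d c t) ↔ d k = d 0 := by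
    intro k
    induction k with
    | zero => simp
    | succ k ih =>
      rw [Finset.sum_range_succ, Int.even_add, ih]
      have a0 := h.advance 0
      have as := h.advance k
      have at' := h.advance (k + 1)
      have al := h.alternate k
      have cs := h.side k
      have ct := h.side (k + 1)
      have ls := h.line k
      have lt := h.line (k + 1)
      have hk := hv k
      rw [show k + 1 + 1 = k + 2 from rfl] at *
      unfold turning
      have key : Even (if d k = d (k + 1) then 0 else d k * c k + d (k + 1) * c (k + 1)) ↔
          d k = d (k + 1) := by
        rcases eq_or_ne (d k) (d (k + 1)) with e | e
        · simp [e]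
        · rw [if_neg e, iff_false_right e, Int.not_even_iff_odd]
          rcases as with ⟨ds, as⟩ | ⟨ds, as⟩ <;> rcases at' with ⟨dt, at'⟩ | ⟨dt, at'⟩ <;>
          rw [ds, dt, Int.odd_iff] <;> omega
      rw [key]
      omega
  exact (key m).mpr hd

/-- A simple closed arch walk is not a proper power of a sequence of steps: its turning is `±2`, and
the turning of one period is even. -/
theorem eq_one_of_periodic (h : IsArchWalk v d c) {k m : ℕ} (hk : 3 ≤ k * m)
    (hv : ∀ s t, v s = v t ↔ s ≡ t [MOD k * m]) (hd : ∀ t, d (t + m) = d t)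
    (hc : ∀ t, c (t + m) = c t) (hmin : ∀ t, v 0 ≤ v t) : k = 1 := by
  have hper : ∀ t, v (t + k * m) = v t := fun t => (hv _ _).mpr (by simp [Nat.ModEq])
  have hinj : ∀ s t, s < k * m → t < k * m → v s = v t → s = t :=
    fun s t hs ht e => Nat.ModEq.eq_of_lt_of_lt ((hv s t).mp e) hs ht
  have hne : ∀ t, v t ≠ v (t + 2) := by
    intro t e
    have := (Nat.modEq_iff_dvd' (by omega)).mp ((hv _ _).mp e)
    have := Nat.le_of_dvd (by omega) this
    omega
  have hd' : ∀ k t, d (t + k * m) = d t := fun k => Function.Periodic.nat_mul (f := d) hd k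
  have hc' : ∀ k t, c (t + k * m) = c t := fun k => Function.Periodic.nat_mul (f := c) hc k
  have hsum : ∀ k, ∑ t ∈ Finset.range (k * m), turning d c t =
      k * ∑ t ∈ Finset.range m, turning d c t := by
    intro k
    induction k with
    | zero => simp
    | succ k ih =>
      rw [Nat.succ_mul, Finset.sum_range_add, ih]
      push_cast
      rw [add_mul, one_mul]
      congr 1
      refine Finset.sum_congr rfl fun t _ => ?_
      simp only [turning, add_comm (k * m), add_right_comm t (k * m) 1, hd', hc']
  obtain ⟨n, hn⟩ : ∃ n, k * m = n + 3 := ⟨k * m - 3, by omega⟩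
  have htot := h.sum_turning (n := n) (by rwa [← hn]) (by rw [← hn]; exact hd' k)
    (by rw [← hn]; exact hc' k) (by rwa [← hn]) hmin
  rw [← hn, hsum] at htot
  obtain ⟨w, hw⟩ := h.even_sum_turning hne (m := m) (by simpa using hd 0)
  rw [hw] at htot
  have h1 : (k : ℤ) * w = 1 ∨ (k : ℤ) * w = -1 := by
    rcases htot with e | e
    · left; linarith
    · right; linarith
  have : IsUnit (k : ℤ) := by
    rcases h1 with e | e
    · exact IsUnit.of_mul_eq_one _ e
    · exact IsUnit.of_mul_eq_one (-w) (by linarith)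
  simpa using Int.isUnit_iff_natAbs_eq.mp this

end IsArchWalk

/-! ### Stack heights and the matching relation -/

/-- The contribution of a letter to the height of stack `s`. -/
noncomputable def CallReturnAlphabet.weight {K : ℕ} {A : Type*} (S : CallReturnAlphabet K A)
    (s : Fin K) (a : A) : ℤ :=
  open Classical in if a ∈ S.calls s then 1 else if a ∈ S.returns s then -1 else 0

namespace CallReturnAlphabet

variable {K : ℕ} {A : Type*} {S : CallReturnAlphabet K A} {s : Fin K}

theorem weight_of_mem_calls {a : A} (h : a ∈ S.calls s) : S.weight s a = 1 := if_pos h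

theorem weight_of_mem_returns {a : A} (h : a ∈ S.returns s) : S.weight s a = -1 := by
  have : a ∉ S.calls s := by
    simp only [calls, returns, Set.mem_ofPred_eq] at h ⊢
    simp [h]
  rw [weight, if_neg this, if_pos h]

/-- A well formed string leaves the height of the stack unchanged and never falls below its initial
height. -/
theorem WellFormed.sum_weight {w : List A} (h : S.WellFormed s w) :
    (w.map (S.weight s)).sum = 0 ∧ ∀ k, 0 ≤ ((w.take k).map (S.weight s)).sum := by
  induction h with
  | @wrap a b w ha hb hw ih =>
    refine ⟨by simp [weight_of_mem_calls ha, weight_of_mem_returns hb, ih.1], fun k => ?_⟩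
    rcases k with _ | k
    · simp
    · rw [List.take_succ_cons, List.take_append, List.map_cons, List.map_append, List.sum_cons,
        List.sum_append, weight_of_mem_calls ha]
      have h₁ := ih.2 k
      have h₂ : -1 ≤ ((([b] : List A).take (k - w.length)).map (S.weight s)).sum := by
        rcases k - w.length with _ | l <;> simp [weight_of_mem_returns hb]
      omega
  | @append v w hv hw ihv ihw =>
    refine ⟨by simp [ihv.1, ihw.1], fun k => ?_⟩
    rw [List.take_append, List.map_append, List.sum_append]
    exact add_nonneg (ihv.2 k) (ihw.2 _)
  | nil => simp
  | @single c h₁ h₂ =>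
    have : S.weight s c = 0 := by rw [weight, if_neg h₁, if_neg h₂]
    refine ⟨by simp [this], fun k => ?_⟩
    rcases k with _ | k <;> simp [this]

end CallReturnAlphabet

namespace NestedWord

variable {K : ℕ} {A : Type*} {S : CallReturnAlphabet K A} (W : NestedWord S)

/-- The height of stack `s` before position `i` is read, where unmatched returns count as `-1`. -/
noncomputable def height (s : Fin K) (i : ℕ) : ℤ :=
  (((List.ofFn W.label).take i).map (S.weight s)).sum

variable {W} {s : Fin K}

theorem height_add (i k : ℕ) : W.height s (i + k) = W.height s i +
    ((((List.ofFn W.label).drop i).take k).map (S.weight s)).sum := by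
  rw [height, height, List.take_add, List.map_append, List.sum_append]

theorem height_succ (i : W.Node) :
    W.height s (i.val + 1) = W.height s i.val + S.weight s (W.label i) := by
  have hi : i.val < (List.ofFn W.label).length := by simp
  simp only [height, List.take_add_one, List.getElem?_eq_getElem hi, List.getElem_ofFn]
  simp

theorem muStack.height_call {i j : W.Node} (h : W.muStack s i j) :
    W.height s (i.val + 1) = W.height s i.val + 1 := by
  rw [height_succ, CallReturnAlphabet.weight_of_mem_calls h.2.1]

theorem muStack.height_le {i j : W.Node} (h : W.muStack s i j) {l : ℕ} (h₁ : i.val < l)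
    (h₂ : l ≤ j.val) : W.height s (i.val + 1) ≤ W.height s l := by
  obtain ⟨k, rfl⟩ := Nat.exists_eq_add_of_le h₁
  have := h.2.2.2.sum_weight.2 k
  rw [between, List.take_take, min_eq_left (by omega)] at this
  rw [Nat.succ_eq_add_one, height_add (i.val + 1)]
  omega

theorem muStack.height_eq {i j : W.Node} (h : W.muStack s i j) :
    W.height s j.val = W.height s (i.val + 1) := by
  have hij : i.val < j.val := h.1
  obtain ⟨k, hk⟩ := Nat.exists_eq_add_of_le hij
  have := h.2.2.2.sum_weight.1
  rw [between, hk, show i.val.succ + k - (i.val + 1) = k by omega] at this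
  rw [hk, Nat.succ_eq_add_one, height_add (i.val + 1)]
  omega

theorem muStack.height_ret {i j : W.Node} (h : W.muStack s i j) :
    W.height s (j.val + 1) = W.height s i.val := by
  rw [height_succ, CallReturnAlphabet.weight_of_mem_returns h.2.2.1, h.height_eq, h.height_call]
  omega

/-- The matching edges of one stack do not cross. -/
theorem muStack.not_crossing {i j k l : W.Node} (h : W.muStack s i j) (h' : W.muStack s k l)
    (h₁ : i < k) (h₂ : k < j) : l ≤ j := by
  by_contra! h₃
  have e₁ := h.height_eq
  have e₂ := h.height_le (l := k) h₁ h₂.le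
  have e₃ := h'.height_call
  have e₄ := h'.height_le (l := j) h₂ h₃.le
  omega

theorem muStack.right_le {i j j' : W.Node} (h : W.muStack s i j) (h' : W.muStack s i j') :
    j' ≤ j := by
  by_contra! h₁
  have hij : i.val < j.val := h.1
  have hj : j.val < j'.val := h₁
  have e₁ := h.height_ret
  have e₂ := h.height_call
  have e₃ := h'.height_le (l := j + 1) (by omega) (by omega)
  omega

theorem muStack.left_le {i i' j : W.Node} (h : W.muStack s i j) (h' : W.muStack s i' j) :
    i' ≤ i := by
  by_contra! h₁
  have hij : i'.val < j.val := h'.1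
  have hi : i.val < i'.val := h₁
  have e₁ := h.height_eq
  have e₂ := h'.height_eq
  have e₃ := h'.height_call
  have e₄ := h.height_le (l := i') (by omega) (by omega)
  omega

theorem muStack.kind_call {i j : W.Node} (h : W.muStack s i j) :
    S.kind (W.label i) = .call s := h.2.1

theorem muStack.kind_ret {i j : W.Node} (h : W.muStack s i j) :
    S.kind (W.label j) = .ret s := h.2.2.1

theorem mu.lt {i j : W.Node} (h : W.mu i j) : i < j := h.elim fun _ h => h.1

theorem mu.right_unique {i j j' : W.Node} (h : W.mu i j) (h' : W.mu i j') : j = j' := by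
  obtain ⟨s, h⟩ := h
  obtain ⟨s', h'⟩ := h'
  have : s = s' := by simpa using h.kind_call.symm.trans h'.kind_call
  subst this
  exact le_antisymm (h'.right_le h) (h.right_le h')

theorem mu.left_unique {i i' j : W.Node} (h : W.mu i j) (h' : W.mu i' j) : i = i' := by
  obtain ⟨s, h⟩ := h
  obtain ⟨s', h'⟩ := h'
  have : s = s' := by simpa using h.kind_ret.symm.trans h'.kind_ret
  subst this
  exact le_antisymm (h'.left_le h) (h.left_le h')

theorem mu.not_mu {i j k : W.Node} (h : W.mu i j) (h' : W.mu j k) : False := by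
  obtain ⟨s, h⟩ := h
  obtain ⟨s', h'⟩ := h'
  simpa using h.kind_ret.symm.trans h'.kind_call

theorem mu.mem_allReturns {i j : W.Node} (h : W.mu i j) : W.label j ∈ S.allReturns := by
  obtain ⟨s, h⟩ := h
  exact Set.mem_iUnion.mpr ⟨s, h.2.2.1⟩

theorem succ.right_unique {i j j' : W.Node} (h : W.succ i j) (h' : W.succ i j') : j = j' :=
  Fin.ext (h.symm.trans h')

theorem succ.left_unique {i i' j : W.Node} (h : W.succ i j) (h' : W.succ i' j) : i = i' :=
  Fin.ext (Nat.succ.inj (h.trans h'.symm))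

end NestedWord

/-! ### Partial covers and lifts of cycles -/

/-- One step along one of two binary relations, `R` or `T` as told by the second component of `e`,
in forward or backward direction as told by the first one. -/
def StepRel {α : Type*} (R T : α → α → Prop) (e : Bool × Bool) (x y : α) : Prop :=
  match e with
  | (true, false) => R x y
  | (false, false) => R y x
  | (true, true) => T x y
  | (false, true) => T y x

namespace StepRel

variable {α : Type*} {R T : α → α → Prop}

theorem reverse {e : Bool × Bool} {x y : α} (h : StepRel R T e x y) :
    StepRel R T (!e.1, e.2) y x := by
  rcases e with ⟨_ | _, _ | _⟩ <;> exact h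

theorem exists_iff {x y : α} :
    (∃ e, StepRel R T e x y) ↔ (R x y ∨ T x y) ∨ (R y x ∨ T y x) := by
  constructor
  · rintro ⟨⟨_ | _, _ | _⟩, h⟩ <;> simp only [StepRel] at h <;> simp [h]
  · rintro ((h | h) | (h | h))
    exacts [⟨(true, false), h⟩, ⟨(true, true), h⟩, ⟨(false, false), h⟩, ⟨(false, true), h⟩]

end StepRel

namespace NestedWord

section

variable {K : ℕ} {A : Type*} {S : CallReturnAlphabet K A} (W : NestedWord S)

/-- A step along an edge of a nested word. -/
abbrev Step (e : Bool × Bool) (i j : W.Node) : Prop := StepRel W.succ W.mu e i j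

variable {W}

theorem Step.right_unique {e : Bool × Bool} {i j j' : W.Node} (h : W.Step e i j)
    (h' : W.Step e i j') : j = j' := by
  rcases e with ⟨_ | _, _ | _⟩
  exacts [succ.left_unique h h', mu.left_unique h h', succ.right_unique h h', mu.right_unique h h']

theorem Step.left_unique {e : Bool × Bool} {i i' j : W.Node} (h : W.Step e i j)
    (h' : W.Step e i' j) : i = i' :=
  Step.right_unique (StepRel.reverse h) (StepRel.reverse h')

theorem Step.irrefl {e : Bool × Bool} {i : W.Node} (h : W.Step e i i) : False := by
  rcases e with ⟨_ | _, _ | _⟩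
  exacts [Nat.succ_ne_self _ h, (mu.lt h).false, Nat.succ_ne_self _ h, (mu.lt h).false]

end

variable {A : Type*} {S : CallReturnAlphabet 2 A} {W : NestedWord S}

/-- The side of the line of positions on which the matching edges of a letter are drawn: above for
the first stack, below for the second one. -/
def side : ActionKind 2 → ℤ
  | .call s => if s = 0 then 1 else -1
  | .ret s => if s = 0 then 1 else -1
  | .internal => 0

theorem side_eq (a : ActionKind 2) : side a = 0 ∨ side a = 1 ∨ side a = -1 := by
  rcases a with s | s | _ <;> simp only [side] <;> try split_ifs
  all_goals simp

theorem exists_muStack_of_step {f : Bool} {i j : W.Node} (h : W.Step (f, true) i j) :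
    ∃ s : Fin 2, W.muStack s (min i j) (max i j) ∧
      side (S.kind (W.label i)) = if s = 0 then 1 else -1 := by
  rcases f with _ | _
  · obtain ⟨s, h⟩ := h
    refine ⟨s, ?_, by rw [h.kind_ret, side]⟩
    rwa [min_eq_right h.1.le, max_eq_left h.1.le]
  · obtain ⟨s, h⟩ := h
    refine ⟨s, ?_, by rw [h.kind_call, side]⟩
    rwa [min_eq_left h.1.le, max_eq_right h.1.le]

/-- A walk in a nested word over two stacks that does not turn back is drawn in the plane with the
positions on a line and the matching edges of the two stacks as semicircles above and below. -/
theorem isArchWalk {v : ℕ → W.Node} {e : ℕ → Bool × Bool}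
    (hv : ∀ t, W.Step (e t) (v t) (v (t + 1))) (hne : ∀ t, v t ≠ v (t + 2)) :
    IsArchWalk (fun t => ((v t).val : ℤ)) (fun t => if (e t).1 then 1 else -1)
      (fun t => if (e t).2 then side (S.kind (W.label (v t))) else 0) where
  advance t := by
    have h := hv t
    generalize e t = a at h ⊢
    rcases a with ⟨_ | _, _ | _⟩
    · exact .inr ⟨by simp, by have : (v (t + 1)).val + 1 = (v t).val := h; omega⟩
    · exact .inr ⟨by simp, by have : (v (t + 1)).val < (v t).val := mu.lt h; omega⟩
    · exact .inl ⟨by simp, by have : (v t).val + 1 = (v (t + 1)).val := h; omega⟩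
    · exact .inl ⟨by simp, by have : (v t).val < (v (t + 1)).val := mu.lt h; omega⟩
  side t := by
    split_ifs
    · exact side_eq _
    · exact .inl rfl
  line t := by
    have h := hv t
    generalize e t = a at h ⊢
    rcases a with ⟨f, _ | _⟩
    · intro _
      rcases f with _ | _
      · have : (v (t + 1)).val + 1 = (v t).val := h
        simp only [Bool.false_eq_true, if_false]; omega
      · have : (v t).val + 1 = (v (t + 1)).val := h
        simp only [if_true]; omega
    · obtain ⟨s, -, hs⟩ := exists_muStack_of_step h
      intro h0
      rw [if_pos rfl, hs] at h0
      split_ifs at h0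
      omega
  alternate t := by
    have h := hv t
    have h' := hv (t + 1)
    have hn := hne t
    generalize e t = a at h ⊢
    generalize e (t + 1) = b at h' ⊢
    rcases a with ⟨f, _ | _⟩
    · exact .inl rfl
    rcases b with ⟨f', _ | _⟩
    · exact .inr rfl
    exfalso
    rcases f with _ | _ <;> rcases f' with _ | _
    · exact mu.not_mu h' h
    · exact hn (mu.right_unique h h')
    · exact hn (mu.left_unique h h')
    · exact mu.not_mu h h'
  noncross s t := by
    have h := hv s
    have h' := hv t
    generalize e s = p at h ⊢
    generalize e t = q at h' ⊢
    rcases p with ⟨f, _ | _⟩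
    · intro _ h; simp at h
    rcases q with ⟨f', _ | _⟩
    · intro h h'; exact absurd h h'
    obtain ⟨a, ha, ha'⟩ := exists_muStack_of_step h
    obtain ⟨b, hb, hb'⟩ := exists_muStack_of_step h'
    simp only [if_true, ha', hb']
    intro hab _
    have : a = b := by
      revert hab; fin_cases a <;> fin_cases b <;> simp
    subst this
    have := ha.not_crossing hb
    simp only [Fin.lt_def, Fin.le_def, Fin.coe_max, Fin.coe_min] at this
    omega

end NestedWord

/-- A partial map from the nodes of a nested word to the elements of a labelled structure, given
by its graph `P`, that preserves labels, reflects and preserves edges, and along which all edges of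
the structure can be lifted. -/
structure IsPartialCover {K : ℕ} {A : Type*} {S : CallReturnAlphabet K A} (W : NestedWord S)
    (M : LabelledStructure A) (P : W.Node → M.Carrier → Prop) : Prop where
  functional : ∀ {j x y}, P j x → P j y → x = y
  label : ∀ {j x}, P j x → W.label j = M.label x
  lift : ∀ {e j x y}, P j x → StepRel M.succ M.mu e x y → ∃ k, W.Step e j k ∧ P k y
  map_step : ∀ {e j k x y}, P j x → P k y → W.Step e j k → StepRel M.succ M.mu e x y

namespace IsPartialCover

variable {A : Type*} {S : CallReturnAlphabet 2 A} {W : NestedWord S} {M : LabelledStructure A}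
  {P : W.Node → M.Carrier → Prop}

/-- An infinite walk in the structure lifts to a walk that starts at any given node over its first
element. -/
theorem exists_lift (h : IsPartialCover W M P) {x : ℕ → M.Carrier} {e : ℕ → Bool × Bool}
    (hx : ∀ t, StepRel M.succ M.mu (e t) (x t) (x (t + 1))) {j : W.Node} (hj : P j (x 0)) :
    ∃ v : ℕ → W.Node, v 0 = j ∧ ∀ t, P (v t) (x t) ∧ W.Step (e t) (v t) (v (t + 1)) := by
  choose f hf hf' using fun (t : ℕ) (j : {j // P j (x t)}) => h.lift j.2 (hx t)
  let v : (t : ℕ) → {j // P j (x t)} := fun t =>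
    Nat.rec (motive := fun t => {j // P j (x t)}) ⟨j, hj⟩ (fun t j => ⟨f t j, hf' t j⟩) t
  exact ⟨fun t => (v t).1, rfl, fun t => ⟨(v t).2, hf t (v t)⟩⟩

/-- A simple cycle lifts to a closed walk.  Continued forever, its lift closes up after some number
`k` of rounds to a simple closed curve in the plane, and then `k = 1` by counting turns. -/
theorem lift_closed (h : IsPartialCover W M P) (hirr : ∀ e x, ¬StepRel M.succ M.mu e x x) {m : ℕ}
    {x : ℕ → M.Carrier} {e : ℕ → Bool × Bool}
    (hx : ∀ t, StepRel M.succ M.mu (e t) (x t) (x (t + 1))) (he : ∀ t, e (t + m) = e t)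
    (hxm : ∀ s t, x s = x t ↔ s ≡ t [MOD m]) {v : ℕ → W.Node} (hv : ∀ t, P (v t) (x t))
    (hvs : ∀ t, W.Step (e t) (v t) (v (t + 1))) : v m = v 0 := by
  have hmod : ∀ {s t}, v s = v t → s ≡ t [MOD m] := fun {s t} hst =>
    (hxm s t).mp (h.functional (hv s) (hst ▸ hv t))
  have he' : ∀ {s t}, s ≡ t [MOD m] → e s = e t := by
    intro s t hst
    rw [← Function.Periodic.map_mod_nat (f := e) he s, hst,
      Function.Periodic.map_mod_nat (f := e) he t]
  have hback : ∀ s t, v (s + 1) = v (t + 1) → v s = v t := by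
    intro s t hst
    have h₁ := hvs s
    rw [hst, he' (Nat.ModEq.add_right_cancel' 1 (hmod hst))] at h₁
    exact h₁.left_unique (hvs t)
  have hdesc : ∀ s t, v s = v (s + t) → v 0 = v t := by
    intro s
    induction s with
    | zero => intro t ht; simpa using ht
    | succ s ih => exact fun t ht => ih t (hback _ _ (by rwa [add_right_comm] at ht))
  have hex : ∃ N, 0 < N ∧ v 0 = v N := by
    obtain ⟨s, t, hne, hst⟩ := Finite.exists_ne_map_eq_of_infinite v
    rcases hne.lt_or_gt with hlt | hlt
    · exact ⟨t - s, by omega, hdesc s _ (by rwa [Nat.add_sub_cancel' hlt.le])⟩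
    · exact ⟨s - t, by omega, hdesc t _ (by rw [Nat.add_sub_cancel' hlt.le]; exact hst.symm)⟩
  -- The lift closes up after `N` steps and not before, so it is a simple closed curve.
  classical
  obtain ⟨hN, hN0⟩ := Nat.find_spec hex
  have hmin : ∀ d, d < Nat.find hex → v 0 = v d → d = 0 := fun d hd h0 => by
    by_contra hd0
    exact Nat.find_min hex hd ⟨Nat.pos_of_ne_zero hd0, h0⟩
  generalize Nat.find hex = N at hN hN0 hmin
  obtain ⟨k, rfl⟩ : ∃ k, N = k * m := by
    obtain ⟨k, hk⟩ := (Nat.modEq_zero_iff_dvd).mp (hmod hN0).symm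
    exact ⟨k, by rw [hk, mul_comm]⟩
  have hper : Function.Periodic v (k * m) := by
    intro t
    induction t with
    | zero => rw [zero_add, ← hN0]
    | succ t ih =>
      have h₁ := hvs (t + k * m)
      rw [ih, he' (t := t) (by simp [Nat.ModEq]), add_right_comm] at h₁
      exact h₁.right_unique (hvs t)
  have hiff' : ∀ s t, s ≤ t → v s = v t → s ≡ t [MOD k * m] := by
    intro s t hle hst
    obtain ⟨d, rfl⟩ := Nat.exists_eq_add_of_le hle
    have h₁ := hdesc _ _ hst
    rw [← hper.map_mod_nat d] at h₁
    have h₂ := hmin _ (Nat.mod_lt _ hN) h₁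
    exact (Nat.modEq_iff_dvd' hle).mpr (by simpa using Nat.dvd_of_mod_eq_zero h₂)
  have hiff : ∀ s t, v s = v t ↔ s ≡ t [MOD k * m] := by
    refine fun s t => ⟨fun hst => ?_, fun hst => ?_⟩
    · rcases le_total s t with hle | hle
      · exact hiff' s t hle hst
      · exact (hiff' t s hle hst.symm).symm
    · rw [← hper.map_mod_nat s, hst, hper.map_mod_nat t]
  by_contra hvm
  have hk : 2 ≤ k := by
    rcases k with _ | _ | k
    · simp at hN
    · exact absurd (by simpa using hN0.symm) hvm
    · omega
  have hm : 2 ≤ m := by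
    rcases m with _ | _ | m
    · simp at hN
    · have e₁ : x 0 = x 1 := (hxm 0 1).mpr (by simp [Nat.ModEq])
      exact absurd (e₁ ▸ hx 0) (by rw [zero_add, ← e₁]; exact hirr _ _)
    · omega
  have hkm : 3 ≤ k * m := by nlinarith
  have hne : ∀ t, v t ≠ v (t + 2) := by
    intro t e
    have := Nat.le_of_dvd (by omega) ((Nat.modEq_iff_dvd' (by omega)).mp ((hiff _ _).mp e))
    omega
  -- The turns are counted from the leftmost node of the curve.
  obtain ⟨t₀, -, ht₀⟩ := Finset.exists_min_image (Finset.range (k * m)) v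
    ⟨0, Finset.mem_range.mpr hN⟩
  have hw := NestedWord.isArchWalk (v := fun t => v (t₀ + t)) (e := fun t => e (t₀ + t))
    (fun t => hvs (t₀ + t)) (fun t => hne (t₀ + t))
  have h1 := hw.eq_one_of_periodic (k := k) (m := m) hkm ?_ ?_ ?_ ?_
  · omega
  · intro s t
    rw [Nat.cast_inj, ← Fin.ext_iff, hiff]
    exact Nat.ModEq.add_iff_left rfl
  · intro t
    simp only [← add_assoc, he]
  · intro t
    simp only [← add_assoc, he, h.label (hv _)]
    rw [(hxm (t₀ + t + m) (t₀ + t)).mpr (by simp [Nat.ModEq])]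
  · intro t
    have := ht₀ ((t₀ + t) % (k * m)) (Finset.mem_range.mpr (Nat.mod_lt _ hN))
    rw [hper.map_mod_nat] at this
    exact_mod_cast this

/-- The graph on the domain of a partial cover. -/
def graph (P : W.Node → M.Carrier → Prop) : SimpleGraph W.Node where
  Adj i j := i ≠ j ∧ (∃ e, W.Step e i j) ∧ (∃ x, P i x) ∧ ∃ x, P j x
  symm := ⟨fun _ _ h => ⟨h.1.symm, h.2.1.imp' _ fun _ => StepRel.reverse, h.2.2.2, h.2.2.1⟩⟩
  loopless := ⟨fun _ h => h.1 rfl⟩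

theorem _root_.SimpleGraph.Walk.exists_segment {V : Type*} {G : SimpleGraph V} {u w : V}
    (p : G.Walk u w) {s t : ℕ} (hst : s ≤ t) (ht : t ≤ p.length) :
    ∃ q : G.Walk (p.getVert s) (p.getVert t), q.length = t - s := by
  refine ⟨((p.drop s).take (t - s)).copy rfl ?_, ?_⟩
  · rw [SimpleGraph.Walk.drop_getVert, Nat.add_sub_cancel' hst]
  · rw [SimpleGraph.Walk.length_copy, SimpleGraph.Walk.take_length, SimpleGraph.Walk.drop_length]
    omega

/-- Every connected component of the domain of a partial cover is mapped injectively.  A shortest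
walk between two distinct nodes with the same image projects to a simple cycle. -/
theorem eq_of_reachable (h : IsPartialCover W M P) (hirr : ∀ e x, ¬StepRel M.succ M.mu e x x)
    {i j : W.Node} {x : M.Carrier} (hi : P i x) (hj : P j x) (hij : (graph P).Reachable i j) :
    i = j := by
  classical
  by_contra hne
  obtain ⟨p₀⟩ := hij
  have hex : ∃ l, ∃ (i j : W.Node) (x : M.Carrier) (p : (graph P).Walk i j),
    p.length = l ∧ P i x ∧ P j x ∧ i ≠ j := ⟨_, i, j, x, p₀, rfl, hi, hj, hne⟩
  obtain ⟨i, j, x₀, p, hl, hi, hj, hne⟩ := Nat.find_spec hex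
  have hmin : ∀ {a b : W.Node} {y : M.Carrier} (q : (graph P).Walk a b), q.length < p.length →
      P a y → P b y → a = b := by
    intro a b y q hq ha hb
    by_contra hab
    exact Nat.find_min hex (hl ▸ hq) ⟨a, b, y, q, rfl, ha, hb, hab⟩
  clear hl hex
  have hpos : 0 < p.length := by
    rw [Nat.pos_iff_ne_zero]
    exact fun h0 => hne (SimpleGraph.Walk.eq_of_length_eq_zero h0)
  have hadj : ∀ t, t < p.length → (graph P).Adj (p.getVert t) (p.getVert (t + 1)) :=
    fun t ht => p.adj_getVert_succ ht
  have hX : ∀ t, ∃ y, t ≤ p.length → P (p.getVert t) y := by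
    intro t
    rcases Nat.lt_or_ge t p.length with ht | ht
    · exact (hadj t ht).2.2.1.imp fun _ h _ => h
    · refine ⟨x₀, fun ht' => ?_⟩
      rwa [le_antisymm ht' ht, SimpleGraph.Walk.getVert_length]
  choose X hX using hX
  have hE : ∀ t, ∃ e, t < p.length → W.Step e (p.getVert t) (p.getVert (t + 1)) := by
    intro t
    by_cases ht : t < p.length
    · exact (hadj t ht).2.1.imp fun _ h _ => h
    · exact ⟨(true, true), fun h => absurd h ht⟩
  choose E hE using hE
  have hX0 : X p.length = X 0 := by
    rw [h.functional (hX 0 (Nat.zero_le _)) (by simpa using hi),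
      h.functional (hX _ le_rfl) (by simpa using hj)]
  have hXinj : ∀ s t, s < t → t < p.length → X s ≠ X t := by
    intro s t hst ht he
    obtain ⟨q, hq⟩ := p.exists_segment hst.le ht.le
    have heq := hmin q (by omega) (hX s (by omega)) (he ▸ hX t ht.le)
    obtain ⟨q₁, hq₁⟩ := p.exists_segment (Nat.zero_le s) (by omega)
    obtain ⟨q₂, hq₂⟩ := p.exists_segment ht.le le_rfl
    refine hne ?_
    have := hmin (y := x₀) (q₁.append (q₂.copy heq.symm rfl))
      (by rw [SimpleGraph.Walk.length_append, SimpleGraph.Walk.length_copy]; omega)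
      (by simpa using hi) (by simpa using hj)
    simpa using this
  have hmodlt : ∀ t, t % p.length < p.length := fun t => Nat.mod_lt _ hpos
  have hx : ∀ t, StepRel M.succ M.mu (E (t % p.length)) (X (t % p.length))
      (X ((t + 1) % p.length)) := by
    intro t
    have h₁ := h.map_step (hX _ (hmodlt t).le) (hX _ (hmodlt t)) (hE _ (hmodlt t))
    rw [Nat.add_mod]
    rcases Nat.lt_or_ge (t % p.length + 1) p.length with hlt | hge
    · rwa [Nat.mod_eq_of_lt (b := p.length) (a := 1) (by omega), Nat.mod_eq_of_lt hlt]
    · have h₂ : t % p.length + 1 = p.length := le_antisymm (hmodlt t) hge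
      rw [← Nat.add_mod, ← Nat.mod_add_mod, h₂, Nat.mod_self, ← hX0]
      rwa [Nat.succ_eq_add_one, h₂] at h₁
  obtain ⟨v, hv0, hv⟩ := h.exists_lift hx (j := i)
    (by simpa using hX 0 (Nat.zero_le _))
  have hclosed := h.lift_closed hirr hx (m := p.length) (fun t => by simp)
    (fun s t => ⟨fun hst => ?_, fun hst => by rw [hst]⟩) (fun t => (hv t).1) (fun t => (hv t).2)
  · have hvp : ∀ t, t ≤ p.length → v t = p.getVert t := by
      intro t
      induction t with
      | zero => simp [hv0]
      | succ t ih =>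
        intro ht
        have h₁ := (hv t).2
        rw [ih (by omega), Nat.mod_eq_of_lt ht] at h₁
        exact h₁.right_unique (hE t ht)
    rw [hvp _ le_rfl, hv0, SimpleGraph.Walk.getVert_length] at hclosed
    exact hne hclosed.symm
  · rcases lt_trichotomy (s % p.length) (t % p.length) with hlt | heq | hlt
    · exact absurd hst (hXinj _ _ hlt (hmodlt t))
    · exact heq
    · exact absurd hst.symm (hXinj _ _ hlt (hmodlt s))

end IsPartialCover

/-! ### Distances and spheres -/

theorem SimpleGraph.edist_le_add_one_iff {V : Type*} {G : SimpleGraph V} {u v : V} {n : ℕ} :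
    G.edist u v ≤ (n + 1 : ℕ) ↔ G.edist u v ≤ n ∨ ∃ w, G.edist u w ≤ n ∧ G.Adj w v := by
  constructor
  · intro h
    have hr := reachable_of_edist_ne_top (ne_top_of_le_ne_top (by simp) h)
    obtain ⟨p, hp⟩ := hr.exists_walk_length_eq_edist
    rw [← hp, Nat.cast_le] at h
    rcases Nat.eq_zero_or_pos p.length with h0 | h0
    · left
      rw [← hp, h0]
      simp
    · right
      have hadj := p.adj_getVert_succ (i := p.length - 1) (by omega)
      rw [Nat.sub_add_cancel h0, Walk.getVert_length] at hadj
      refine ⟨_, (edist_le (p.take (p.length - 1))).trans ?_, hadj⟩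
      rw [Walk.take_length, Nat.cast_le]
      omega
  · rintro (h | ⟨w, h, hw⟩)
    · exact h.trans (by simp)
    · have h₁ := add_le_add h (edist_eq_one_iff_adj.mpr hw).le
      refine SimpleGraph.edist_triangle.trans (h₁.trans ?_)
      simp

namespace NestedWord

section

variable {K : ℕ} {A : Type*} {S : CallReturnAlphabet K A} (W : NestedWord S)

/-- The Gaifman graph of a nested word. -/
def gaifman : SimpleGraph W.Node := W.toStructure.gaifman

/-- The nodes `i` and `j` have distance at most `n`. -/
def Near (n : ℕ) (i j : W.Node) : Prop := W.gaifman.edist i j ≤ (n : ℕ∞)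

variable {W} {i j k : W.Node} {m n : ℕ}

theorem gaifman_adj : W.gaifman.Adj i j ↔ ∃ e, W.Step e i j := by
  refine (SimpleGraph.fromRel_adj _ _ _).trans ?_
  rw [StepRel.exists_iff]
  refine ⟨fun h => h.2, fun h => ⟨?_, h⟩⟩
  rintro rfl
  obtain ⟨e, he⟩ := StepRel.exists_iff.mpr h
  exact Step.irrefl he

theorem near_zero : W.Near 0 i j ↔ i = j := by
  simp [Near]

theorem near_succ : W.Near (n + 1) i j ↔ W.Near n i j ∨ ∃ k, W.Near n i k ∧ ∃ e, W.Step e k j :=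
  SimpleGraph.edist_le_add_one_iff.trans <| or_congr Iff.rfl <|
    exists_congr fun _ => and_congr Iff.rfl gaifman_adj

theorem Near.mono (h : W.Near m i j) (hmn : m ≤ n) : W.Near n i j :=
  h.trans (by exact_mod_cast hmn)

theorem Near.refl (n : ℕ) (i : W.Node) : W.Near n i i := (near_zero.mpr rfl).mono n.zero_le

theorem Near.symm (h : W.Near n i j) : W.Near n j i := by
  unfold Near at *
  rwa [SimpleGraph.edist_comm]

theorem Near.trans (h : W.Near m i j) (h' : W.Near n j k) : W.Near (m + n) i k :=
  SimpleGraph.edist_triangle.trans (by rw [Nat.cast_add]; exact add_le_add h h')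

theorem Near.step (h : W.Near n i j) {e : Bool × Bool} (he : W.Step e j k) :
    W.Near (n + 1) i k :=
  near_succ.mpr (.inr ⟨j, h, e, he⟩)

theorem stepRel_sphere {r : ℕ} {e : Bool × Bool} {x y : (W.sphere r i).Carrier} :
    StepRel (W.sphere r i).succ (W.sphere r i).mu e x y ↔ W.Step e x.1 y.1 := by
  rcases e with ⟨_ | _, _ | _⟩ <;> exact Iff.rfl

end

variable {A : Type*} {S : CallReturnAlphabet 2 A}

/-- A partial cover by a sphere, under which the edges at a node over an interior element of the
sphere all stay in the domain, is an isomorphism from the sphere around a node over the center. -/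
theorem nonempty_iso_of_isPartialCover {W W' : NestedWord S} {r : ℕ} {i : W.Node} {i' : W'.Node}
    {P : W.Node → (W'.sphere r i').Carrier → Prop}
    (h : IsPartialCover W (W'.sphere r i').toLabelledStructure P)
    (hi : P i (W'.sphere r i').center)
    (hint : ∀ {e j k x n}, P j x → W'.Near n i' x.1 → n < r → W.Step e j k → ∃ y, P k y) :
    Nonempty ((W'.sphere r i').Iso (W.sphere r i)) := by
  have hirr : ∀ e x, ¬StepRel (W'.sphere r i').succ (W'.sphere r i').mu e x x :=
    fun e x hx => Step.irrefl (stepRel_sphere.mp hx)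
  have hadj : ∀ {e j k x y}, P j x → P k y → W.Step e j k → (IsPartialCover.graph P).Adj j k := by
    intro e j k x y hj hk he
    refine ⟨?_, ⟨e, he⟩, ⟨x, hj⟩, ⟨y, hk⟩⟩
    rintro rfl
    exact Step.irrefl he
  have hA : ∀ n, n ≤ r → ∀ x : (W'.sphere r i').Carrier, W'.Near n i' x.1 →
      ∃ j, P j x ∧ (IsPartialCover.graph P).Reachable i j ∧ W.Near n i j := by
    intro n
    induction n with
    | zero =>
      intro _ x hx
      have : x = (W'.sphere r i').center := Subtype.ext (near_zero.mp hx).symm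
      exact ⟨i, this ▸ hi, .refl _, .refl _ _⟩
    | succ n ih =>
      intro hn x hx
      rcases near_succ.mp hx with hx | ⟨y, hy, e, he⟩
      · obtain ⟨j, h₁, h₂, h₃⟩ := ih (by omega) x hx
        exact ⟨j, h₁, h₂, h₃.mono n.le_succ⟩
      · obtain ⟨j, h₁, h₂, h₃⟩ := ih (by omega) ⟨y, hy.mono (by omega)⟩ hy
        obtain ⟨k, hk, hkx⟩ := h.lift h₁ (stepRel_sphere.mpr he)
        exact ⟨k, hkx, h₂.trans (hadj h₁ hkx hk).reachable, h₃.step hk⟩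
  have hB : ∀ n, n ≤ r → ∀ j, W.Near n i j →
      ∃ x, P j x ∧ (IsPartialCover.graph P).Reachable i j ∧ W'.Near n i' x.1 := by
    intro n
    induction n with
    | zero =>
      intro _ j hj
      exact ⟨_, near_zero.mp hj ▸ hi, by rw [near_zero.mp hj], .refl _ _⟩
    | succ n ih =>
      intro hn k hk
      rcases near_succ.mp hk with hk | ⟨j, hj, e, he⟩
      · obtain ⟨x, h₁, h₂, h₃⟩ := ih (by omega) k hk
        exact ⟨x, h₁, h₂, h₃.mono n.le_succ⟩
      · obtain ⟨x, h₁, h₂, h₃⟩ := ih (by omega) j hj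
        obtain ⟨y, hy⟩ := hint h₁ h₃ (by omega) he
        exact ⟨y, hy, h₂.trans (hadj h₁ hy he).reachable,
          h₃.step (stepRel_sphere.mp (h.map_step h₁ hy he))⟩
  choose f hf hfr hfn using fun x : (W'.sphere r i').Carrier => hA r le_rfl x x.2
  have heq : ∀ {x j}, P j x → (IsPartialCover.graph P).Reachable i j → f x = j := fun {x j} hj hr =>
    h.eq_of_reachable hirr (hf x) hj ((hfr x).symm.trans hr)
  have hstep : ∀ e x y, W.Step e (f x) (f y) ↔
      StepRel (W'.sphere r i').succ (W'.sphere r i').mu e x y := by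
    refine fun e x y => ⟨h.map_step (hf x) (hf y), fun hxy => ?_⟩
    obtain ⟨k, hk, hky⟩ := h.lift (hf x) hxy
    rwa [heq hky ((hfr x).trans (hadj (hf x) hky hk).reachable)]
  refine ⟨⟨Equiv.ofBijective (fun x => (⟨f x, hfn x⟩ : (W.sphere r i).Carrier)) ⟨?_, ?_⟩,
    fun x y => hstep (true, false) x y, fun x y => hstep (true, true) x y,
    fun x => h.label (hf x), Subtype.ext (heq hi (.refl _))⟩⟩
  · intro x y hxy
    have : f x = f y := congrArg Subtype.val hxy
    exact h.functional (hf x) (this ▸ hf y)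
  · rintro ⟨j, hj⟩
    obtain ⟨x, h₁, h₂, -⟩ := hB r le_rfl j hj
    exact ⟨x, Subtype.ext (heq h₁ h₂)⟩

end NestedWord

/-! ### Colourings and the number of spheres -/

/-- A graph in which every vertex has at most `d` neighbours has a proper colouring with `d + 1`
colours. -/
theorem exists_coloring_of_card_le {α : Type*} [Fintype α] (R : α → α → Prop) [DecidableRel R]
    (hsymm : ∀ i j, R i j → R j i) {d : ℕ} (hd : ∀ i, (Finset.univ.filter (R i)).card ≤ d) :
    ∃ c : α → Fin (d + 1), ∀ i j, R i j → c i = c j → i = j := by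
  classical
  suffices h : ∀ s : Finset α, ∃ c : α → Fin (d + 1),
      ∀ i ∈ s, ∀ j ∈ s, R i j → c i = c j → i = j by
    obtain ⟨c, hc⟩ := h Finset.univ
    exact ⟨c, fun i j => hc i (Finset.mem_univ _) j (Finset.mem_univ _)⟩
  intro s
  induction s using Finset.induction_on with
  | empty => exact ⟨fun _ => 0, by simp⟩
  | insert a s ha ih =>
    obtain ⟨c, hc⟩ := ih
    obtain ⟨q, hq⟩ : ∃ q, q ∉ (Finset.univ.filter (R a)).image c := by
      by_contra! hall
      have h₁ := Finset.card_le_card (fun q _ => hall q : Finset.univ ⊆ _)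
      have h₂ := (Finset.card_image_le (s := Finset.univ.filter (R a)) (f := c)).trans (hd a)
      rw [Finset.card_univ, Fintype.card_fin] at h₁
      omega
    have hq' : ∀ j, R a j → q ≠ c j := fun j hj e =>
      hq (Finset.mem_image.mpr ⟨j, by simpa using hj, e.symm⟩)
    refine ⟨Function.update c a q, fun i hi j hj hR => ?_⟩
    rcases eq_or_ne i a with rfl | hia <;> rcases eq_or_ne j i with rfl | hji
    · simp
    · rw [Function.update_self, Function.update_of_ne hji]
      exact fun e => absurd e (hq' j hR)
    · simp
    · rw [Function.update_of_ne hia]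
      rcases eq_or_ne j a with rfl | hja
      · rw [Function.update_self]
        exact fun e => absurd e.symm (hq' i (hsymm _ _ hR))
      · rw [Function.update_of_ne hja]
        exact hc i (Finset.mem_of_mem_insert_of_ne hi hia) j
          (Finset.mem_of_mem_insert_of_ne hj hja) hR

namespace PointedStructure.Iso

variable {A : Type*} {M N L : PointedStructure A}

/-- The inverse of an isomorphism. -/
def symm (f : M.Iso N) : N.Iso M where
  toEquiv := f.toEquiv.symm
  map_succ x y := by simpa using (f.map_succ (f.toEquiv.symm x) (f.toEquiv.symm y)).symm
  map_mu x y := by simpa using (f.map_mu (f.toEquiv.symm x) (f.toEquiv.symm y)).symm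
  map_label x := by simpa using (f.map_label (f.toEquiv.symm x)).symm
  map_center := by rw [← f.map_center, Equiv.symm_apply_apply]

/-- The composition of two isomorphisms. -/
def trans (f : M.Iso N) (g : N.Iso L) : M.Iso L where
  toEquiv := f.toEquiv.trans g.toEquiv
  map_succ x y := (g.map_succ _ _).trans (f.map_succ x y)
  map_mu x y := (g.map_mu _ _).trans (f.map_mu x y)
  map_label x := (g.map_label _).trans (f.map_label x)
  map_center := (congrArg g.toEquiv f.map_center).trans g.map_center

theorem map_step (f : M.Iso N) {e : Bool × Bool} {x y : M.Carrier} :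
    StepRel N.succ N.mu e (f.toEquiv x) (f.toEquiv y) ↔ StepRel M.succ M.mu e x y := by
  rcases e with ⟨_ | _, _ | _⟩
  exacts [f.map_succ y x, f.map_mu y x, f.map_succ x y, f.map_mu x y]

end PointedStructure.Iso

namespace NestedWord

variable {K : ℕ} {A : Type*} {S : CallReturnAlphabet K A}

/-- Isomorphisms of spheres preserve the distance from the center. -/
theorem Near.map_iso {W W' : NestedWord S} {r : ℕ} {i : W.Node} {i' : W'.Node}
    (f : (W.sphere r i).Iso (W'.sphere r i')) {n : ℕ} (hn : n ≤ r) {x : (W.sphere r i).Carrier}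
    (hx : W.Near n i x.1) : W'.Near n i' (f.toEquiv x).1 := by
  induction n generalizing x with
  | zero =>
    have : x = (W.sphere r i).center := Subtype.ext (near_zero.mp hx).symm
    rw [this, f.map_center]
    exact .refl _ _
  | succ n ih =>
    rcases near_succ.mp hx with hx | ⟨y, hy, e, he⟩
    · exact (ih (by omega) hx).mono n.le_succ
    · exact (ih (x := ⟨y, hy.mono (by omega)⟩) (by omega) hy).step
        (stepRel_sphere.mp (f.map_step.mpr (stepRel_sphere.mpr he)))

open Classical in
theorem card_near_le (W : NestedWord S) (n : ℕ) (i : W.Node) :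
    (Finset.univ.filter (W.Near n i)).card ≤ 5 ^ n := by
  induction n with
  | zero => simp [near_zero, Finset.filter_eq]
  | succ n ih =>
    -- A node at distance `n + 1` is one of at most four neighbours of a node at distance `n`.
    let g : W.Node × Option (Bool × Bool) → W.Node := fun p =>
      p.2.elim p.1 fun e => if h : ∃ j, W.Step e p.1 j then h.choose else p.1
    have hsub : Finset.univ.filter (W.Near (n + 1) i) ⊆
        ((Finset.univ.filter (W.Near n i)) ×ˢ Finset.univ).image g := by
      intro j hj
      rw [Finset.mem_filter_univ, near_succ] at hj
      rw [Finset.mem_image]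
      rcases hj with hj | ⟨k, hk, e, he⟩
      · exact ⟨(j, none), by simpa using hj, rfl⟩
      · refine ⟨(k, some e), by simpa using hk, ?_⟩
        have hex : ∃ j, W.Step e k j := ⟨j, he⟩
        exact (dif_pos hex).trans (hex.choose_spec.right_unique he)
    refine (Finset.card_le_card hsub).trans (Finset.card_image_le.trans ?_)
    rw [Finset.card_product, pow_succ]
    exact Nat.mul_le_mul ih (by decide)

/-- The nodes of nested words have colourings, with a fixed number of colours, that distinguish any
two nodes at distance at most `n`. -/
theorem exists_coloring (W : NestedWord S) (n : ℕ) :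
    ∃ c : W.Node → Fin (5 ^ n + 1), ∀ i j, W.Near n i j → c i = c j → i = j := by
  classical
  exact exists_coloring_of_card_le (W.Near n) (fun _ _ h => h.symm) (W.card_near_le n)

end NestedWord

/-- The pointed structures over `A` on the sets `Fin n` with `n ≤ N`. -/
abbrev SmallStructure (A : Type*) (N : ℕ) : Type _ :=
  Σ n : Fin (N + 1), (Fin n → Fin n → Prop) × (Fin n → Fin n → Prop) × (Fin n → A) × Fin n

/-- A small structure as a pointed structure. -/
def SmallStructure.toPointed {A : Type*} {N : ℕ} (x : SmallStructure A N) : PointedStructure A where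
  Carrier := Fin x.1
  succ := x.2.1
  mu := x.2.2.1
  label := x.2.2.2.1
  center := x.2.2.2.2

theorem PointedStructure.exists_iso_small {A : Type*} {N : ℕ} (M : PointedStructure A)
    [Finite M.Carrier] (hN : Nat.card M.Carrier ≤ N) :
    ∃ x : SmallStructure A N, Nonempty (M.Iso x.toPointed) := by
  have f := Finite.equivFin M.Carrier
  refine ⟨⟨⟨Nat.card M.Carrier, Nat.lt_succ_of_le hN⟩, fun x y => M.succ (f.symm x) (f.symm y),
    fun x y => M.mu (f.symm x) (f.symm y), fun x => M.label (f.symm x), f M.center⟩,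
    ⟨⟨f, fun x y => ?_, fun x y => ?_, fun x => ?_, rfl⟩⟩⟩
  · change M.succ (f.symm (f x)) (f.symm (f y)) ↔ M.succ x y
    rw [f.symm_apply_apply, f.symm_apply_apply]
  · change M.mu (f.symm (f x)) (f.symm (f y)) ↔ M.mu x y
    rw [f.symm_apply_apply, f.symm_apply_apply]
  · exact congrArg M.label (f.symm_apply_apply x)

instance {K : ℕ} {A : Type*} {S : CallReturnAlphabet K A} (W : NestedWord S) (r : ℕ) (i : W.Node) :
    Finite (W.sphere r i).Carrier :=
  inferInstanceAs (Finite {j : W.Node // W.Near r i j})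

/-- Over a finite alphabet there are, up to isomorphism, finitely many spheres of given radius. -/
theorem CallReturnAlphabet.exists_sphere_representatives {K : ℕ} {A : Type*} [Finite A]
    (S : CallReturnAlphabet K A) (r : ℕ) :
    ∃ (N : ℕ) (V : Fin N → NestedWord S) (o : ∀ k, (V k).Node),
      ∀ (W : NestedWord S) (i : W.Node),
        ∃ k, Nonempty ((W.sphere r i).Iso ((V k).sphere r (o k))) := by
  let X := {x : SmallStructure A (5 ^ r) //
    ∃ (W : NestedWord S) (i : W.Node), Nonempty ((W.sphere r i).Iso x.toPointed)}
  choose V o h using fun x : X => x.2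
  have f := Finite.equivFin X
  refine ⟨Nat.card X, fun k => V (f.symm k), fun k => o (f.symm k), fun W i => ?_⟩
  obtain ⟨x, ⟨g⟩⟩ := (W.sphere r i).exists_iso_small (N := 5 ^ r) (by
    classical
    have := W.card_near_le r i
    rw [← Fintype.card_subtype, ← Nat.card_eq_fintype_card] at this
    exact this)
  obtain ⟨k, hk⟩ := f.symm.surjective ⟨x, W, i, ⟨g⟩⟩
  obtain ⟨g'⟩ := h (f.symm k)
  rw [show (f.symm k).1 = x from congrArg Subtype.val hk] at g'
  exact ⟨k, ⟨g.trans g'.symm⟩⟩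

/-! ### The sphere automaton -/

/-- Radius, number of colours, and a finite family of spheres, given by nodes of nested words. -/
structure SphereFamily {K : ℕ} {A : Type*} (S : CallReturnAlphabet K A) where
  radius : ℕ
  colors : ℕ
  size : ℕ
  word : Fin size → NestedWord S
  node : ∀ k, (word k).Node

namespace SphereFamily

variable {K : ℕ} {A : Type*} {S : CallReturnAlphabet K A} (D : SphereFamily S)

/-- The spheres of the family. -/
def sphere (k : Fin D.size) : PointedStructure A := (D.word k).sphere D.radius (D.node k)

/-- A position in one of the spheres of the family. -/
abbrev Position : Type := Σ k, (D.sphere k).Carrier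

variable {D}

/-- A step from one position to another one within the same sphere. -/
def PositionStep (e : Bool × Bool) (a b : D.Position) : Prop :=
  ∃ (k : Fin D.size) (x y : (D.sphere k).Carrier),
    a = ⟨k, x⟩ ∧ b = ⟨k, y⟩ ∧ StepRel (D.sphere k).succ (D.sphere k).mu e x y

/-- The distance of the position from the center is smaller than the radius. -/
def IsInterior (a : D.Position) : Prop :=
  ∃ n, n < D.radius ∧ (D.word a.1).Near n (D.node a.1) a.2.1

variable (D)

/-- A guess about a node `j` of a nested word whose nodes are coloured such that nearby nodes have
different colours: the colour of `j`, the isomorphism type of the sphere around `j`, and, for every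
colour `c`, the sphere around the nearby node of colour `c` together with the position of `j` in it,
if there is such a node.  The flag `start` marks the states before the first position. -/
structure State where
  start : Bool
  color : Fin D.colors
  type : Fin D.size
  entry : Fin D.colors → Option D.Position

instance (k : Fin D.size) : Finite (D.sphere k).Carrier :=
  inferInstanceAs (Finite ((D.word k).sphere D.radius (D.node k)).Carrier)

instance : Finite D.State :=
  Finite.of_injective (fun q : D.State => (q.start, q.color, q.type, q.entry)) fun p q h => by
    cases p
    cases q
    simpa using h

namespace State

variable {D}

/-- The guess at a node labelled by `a` assigns it the center of its own sphere and positions with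
the right label. -/
structure Fits (q : D.State) (a : A) : Prop where
  start_eq : q.start = false
  center : q.entry q.color = some ⟨q.type, (D.sphere q.type).center⟩
  label : ∀ {c b}, q.entry c = some b → (D.sphere b.1).label b.2 = a

/-- The guess `q` requires a neighbour in direction `e`. -/
def Requires (e : Bool × Bool) (q : D.State) : Prop :=
  ∃ c a b, q.entry c = some a ∧ PositionStep e a b

/-- The guess `q'` is what the guess `q` says about the neighbour in direction `e`. -/
structure Extends (e : Bool × Bool) (q q' : D.State) : Prop where
  forward : ∀ {c a b}, q.entry c = some a → PositionStep e a b → q'.entry c = some b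
  step : ∀ {c a b}, q.entry c = some a → q'.entry c = some b → PositionStep e a b
  interior : ∀ {c a}, q.entry c = some a → IsInterior a → ∃ b, q'.entry c = some b

/-- Two guesses agree along an edge, which is a matching edge if `m` is true. -/
def Agree (m : Bool) (q q' : D.State) : Prop := Extends (true, m) q q' ∧ Extends (false, m) q' q

/-- A labelling of a nested word by guesses that agree along all edges. -/
structure IsConsistent (W : NestedWord S) (ρ : W.Node → D.State) : Prop where
  fits : ∀ j, (ρ j).Fits (W.label j)
  extends_of_step : ∀ {e i j}, W.Step e i j → Extends e (ρ i) (ρ j)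
  exists_step : ∀ {e j}, (ρ j).Requires e → ∃ k, W.Step e j k

end State

open State

/-- The automaton whose accepting runs are the consistent labellings. -/
def automaton : GeneralizedMNWA S where
  State := D.State
  finite_state := inferInstance
  δ₁ := {t | t.2.2.Fits t.2.1 ∧ ¬t.2.2.Requires (false, true) ∧
    (t.1.start = true → ¬t.2.2.Requires (false, false)) ∧
    (t.1.start = false → Agree false t.1 t.2.2)}
  δ₂ := {t | t.2.2.2.Fits t.2.2.1 ∧ t.2.2.1 ∈ S.allReturns ∧ Agree false t.2.1 t.2.2.2 ∧
    Agree true t.1 t.2.2.2}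
  δ₂_returns _ _ _ _ h := h.2.1
  initial := {q | q.start = true}
  final := {q | ¬q.Requires (true, false)}
  calling := {q | q.Requires (true, true)}

variable {D}

theorem _root_.NestedWord.eq_first_or_exists_succ {W : NestedWord S} (j : W.Node) :
    j = W.first ∨ ∃ i, W.succ i j := by
  rcases Nat.eq_zero_or_pos j.val with h | h
  · exact .inl (Fin.ext h)
  · exact .inr ⟨⟨j.val - 1, by omega⟩, Nat.sub_add_cancel h⟩

theorem _root_.NestedWord.not_succ_first {W : NestedWord S} {i : W.Node} :
    ¬W.succ i W.first := Nat.succ_ne_zero _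

theorem _root_.NestedWord.not_succ_last {W : NestedWord S} {i : W.Node} :
    ¬W.succ W.last i := fun h => by
  have h₁ : W.length - 1 + 1 = i.val := h
  have := W.length_pos
  omega

theorem isAcceptingRun_iff {W : NestedWord S} {ρ : W.Node → D.State} :
    D.automaton.IsAcceptingRun W ρ ↔ IsConsistent W ρ := by
  constructor
  · rintro ⟨⟨⟨q, hq, h₁⟩, h₂⟩, hfin, hcall⟩
    obtain ⟨hf₁, hm₁, hs₁, -⟩ := h₁
    have hfits : ∀ j, (ρ j).Fits (W.label j) := by
      intro j
      rcases NestedWord.eq_first_or_exists_succ j with rfl | ⟨i, hi⟩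
      · exact hf₁
      · by_cases hc : ∃ c, W.mu c j
        · obtain ⟨c, hc⟩ := hc
          exact ((h₂ i j hi).1 c hc).1
        · exact ((h₂ i j hi).2 hc).1
    have hsucc : ∀ {i j}, W.succ i j → Agree false (ρ i) (ρ j) := by
      intro i j hi
      by_cases hc : ∃ c, W.mu c j
      · obtain ⟨c, hc⟩ := hc
        exact ((h₂ i j hi).1 c hc).2.2.1
      · exact ((h₂ i j hi).2 hc).2.2.2 (hfits i).start_eq
    have hmu : ∀ {i j}, W.mu i j → Agree true (ρ i) (ρ j) := by
      intro i j hi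
      rcases NestedWord.eq_first_or_exists_succ j with rfl | ⟨k, hk⟩
      · exact absurd (NestedWord.mu.lt hi) (Nat.not_lt_zero _)
      · exact ((h₂ k j hk).1 i hi).2.2.2
    refine ⟨hfits, fun {e i j} h => ?_, fun {e j} h => ?_⟩
    · rcases e with ⟨_ | _, _ | _⟩
      exacts [(hsucc h).2, (hmu h).2, (hsucc h).1, (hmu h).1]
    · rcases e with ⟨_ | _, _ | _⟩
      · rcases NestedWord.eq_first_or_exists_succ j with rfl | hi
        exacts [absurd h (hs₁ hq), hi]
      · rcases NestedWord.eq_first_or_exists_succ j with rfl | ⟨i, hi⟩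
        · exact absurd h hm₁
        · by_contra hc
          exact ((h₂ i j hi).2 hc).2.1 h
      · by_cases hj : j.val + 1 < W.length
        · exact ⟨⟨j.val + 1, hj⟩, rfl⟩
        · have : j = W.last := Fin.ext (by
            have h₁ : W.last.val = W.length - 1 := rfl
            omega)
          exact absurd (this ▸ h) hfin
      · exact hcall j h
  · intro h
    refine ⟨⟨⟨{ ρ W.first with start := true }, rfl, h.fits _, fun hr => ?_,
      fun _ hr => ?_, fun h0 => ?_⟩, fun i j hij => ⟨fun c hc => ?_, fun hc => ?_⟩⟩, fun hr => ?_, fun i hi => h.exists_step hi⟩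
    · obtain ⟨k, hk⟩ := h.exists_step hr
      exact absurd (NestedWord.mu.lt hk) (Nat.not_lt_zero _)
    · obtain ⟨k, hk⟩ := h.exists_step hr
      exact NestedWord.not_succ_first hk
    · exact absurd h0 (by simp)
    · exact ⟨h.fits j, hc.mem_allReturns,
        ⟨h.extends_of_step (e := (true, false)) hij, h.extends_of_step (e := (false, false)) hij⟩,
        ⟨h.extends_of_step (e := (true, true)) hc, h.extends_of_step (e := (false, true)) hc⟩⟩
    · refine ⟨h.fits j, fun hr => hc (h.exists_step hr),
        fun h0 => absurd h0 (by simp [(h.fits i).start_eq]), fun _ => ?_⟩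
      exact ⟨h.extends_of_step (e := (true, false)) hij,
        h.extends_of_step (e := (false, false)) hij⟩
    · obtain ⟨k, hk⟩ := h.exists_step hr
      exact NestedWord.not_succ_last hk

/-- The positions in a fixed sphere of the family that a consistent labelling assigns to the nodes
with respect to a fixed colour form a partial cover. -/
theorem State.IsConsistent.isPartialCover {W : NestedWord S} {ρ : W.Node → D.State}
    (h : IsConsistent W ρ) (c : Fin D.colors) (k : Fin D.size) :
    IsPartialCover W (D.sphere k).toLabelledStructure
      (fun j x => (ρ j).entry c = some ⟨k, x⟩) where
  functional h₁ h₂ := by simpa using h₁.symm.trans h₂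
  label h₁ := ((h.fits _).label h₁).symm
  lift {e j x y} h₁ h₂ := by
    have h₃ : PositionStep e (⟨k, x⟩ : D.Position) ⟨k, y⟩ := ⟨k, x, y, rfl, rfl, h₂⟩
    obtain ⟨l, hl⟩ := h.exists_step ⟨c, _, _, h₁, h₃⟩
    exact ⟨l, hl, (h.extends_of_step hl).forward h₁ h₃⟩
  map_step h₁ h₂ h₃ := by
    obtain ⟨k', x', y', hx, hy, hs⟩ := (h.extends_of_step h₃).step h₁ h₂
    obtain rfl : k = k' := congrArg Sigma.fst hx
    obtain rfl := eq_of_heq (Sigma.mk.inj hx).2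
    obtain rfl := eq_of_heq (Sigma.mk.inj hy).2
    exact hs

/-- A nested word whose spheres all occur in the family has a consistent labelling, obtained from a
colouring that distinguishes any two nodes at distance at most `2 * r + 1`. -/
theorem exists_isConsistent {W : NestedWord S} (χ : W.Node → Fin D.colors)
    (hχ : ∀ i j, W.Near (2 * D.radius + 1) i j → χ i = χ j → i = j)
    (hW : ∀ i, ∃ k, Nonempty ((W.sphere D.radius i).Iso (D.sphere k))) :
    ∃ ρ : W.Node → D.State, IsConsistent W ρ := by
  classical
  choose κ hκ using hW
  have φ := fun i => (hκ i).some
  let pos : ∀ i j, W.Near D.radius i j → D.Position := fun i j h => ⟨κ i, (φ i).toEquiv ⟨j, h⟩⟩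
  let entry : W.Node → Fin D.colors → Option D.Position := fun j c =>
    if h : ∃ i, χ i = c ∧ W.Near D.radius i j then some (pos h.choose j h.choose_spec.2) else none
  have hentry : ∀ {j c a}, entry j c = some a →
      ∃ (i : W.Node) (h : W.Near D.radius i j), χ i = c ∧ a = pos i j h := by
    intro j c a ha
    by_cases h : ∃ i, χ i = c ∧ W.Near D.radius i j
    · rw [show entry j c = _ from dif_pos h, Option.some_inj] at ha
      exact ⟨_, _, h.choose_spec.1, ha.symm⟩
    · rw [show entry j c = _ from dif_neg h] at ha
      simp at ha
  have hentry' : ∀ {i j} (h : W.Near D.radius i j), entry j (χ i) = some (pos i j h) := by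
    intro i j hij
    have h : ∃ i', χ i' = χ i ∧ W.Near D.radius i' j := ⟨i, rfl, hij⟩
    have hi : h.choose = i := hχ _ _
      ((h.choose_spec.2.trans hij.symm).mono (by omega)) h.choose_spec.1
    rw [show entry j (χ i) = _ from dif_pos h, Option.some_inj]
    congr!
  have hstep : ∀ {i j} {h : W.Near D.radius i j} {e b}, PositionStep e (pos i j h) b →
      ∃ (k : W.Node) (h' : W.Near D.radius i k), W.Step e j k ∧ b = pos i k h' := by
    rintro i j h e b ⟨k, x, y, hx, rfl, hs⟩
    obtain rfl : κ i = k := congrArg Sigma.fst hx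
    obtain rfl := eq_of_heq (Sigma.mk.inj hx).2
    obtain ⟨z, rfl⟩ := (φ i).toEquiv.surjective y
    exact ⟨z.1, z.2, NestedWord.stepRel_sphere.mp ((φ i).map_step.mp hs), rfl⟩
  refine ⟨fun j => ⟨false, χ j, κ j, entry j⟩, fun j => ⟨rfl, ?_, fun {c b} hb => ?_⟩,
    fun {e j k} hjk => ⟨fun {c a b} ha hab => ?_, fun {c a b} ha hb => ?_, fun {c a} ha hi => ?_⟩,
    fun {e j} hr => ?_⟩
  · refine (hentry' (.refl _ _)).trans ?_
    exact congrArg (fun x => some (⟨κ j, x⟩ : D.Position)) (φ j).map_center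
  · obtain ⟨i, h, -, rfl⟩ := hentry hb
    exact (φ i).map_label ⟨j, h⟩
  · obtain ⟨i, h, rfl, rfl⟩ := hentry ha
    obtain ⟨l, h', hl, rfl⟩ := hstep hab
    obtain rfl := hl.right_unique hjk
    exact hentry' h'
  · obtain ⟨i, h, rfl, rfl⟩ := hentry ha
    obtain ⟨i', h', hc, rfl⟩ := hentry hb
    -- Two centers of the same colour that are near the two ends of an edge coincide.
    obtain rfl := hχ _ _ (((h.step hjk).trans h'.symm).mono (by omega)) hc.symm
    exact ⟨κ i, _, _, rfl, rfl, (φ i).map_step.mpr (NestedWord.stepRel_sphere.mpr hjk)⟩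
  · obtain ⟨i, h, rfl, rfl⟩ := hentry ha
    obtain ⟨n, hn, hi⟩ := hi
    have h₁ : W.Near n i j :=
      (congrArg (fun z => W.Near n i z.1) ((φ i).toEquiv.symm_apply_apply ⟨j, h⟩)).mp
        (NestedWord.Near.map_iso (φ i).symm hn.le hi)
    exact ⟨_, hentry' ((h₁.step hjk).mono hn)⟩
  · obtain ⟨c, a, b, ha, hab⟩ := hr
    obtain ⟨i, h, -, rfl⟩ := hentry ha
    obtain ⟨k, -, hk, -⟩ := hstep hab
    exact ⟨k, hk⟩

end SphereFamily

theorem mainTheorem4 {A : Type*} [Finite A] (S : CallReturnAlphabet 2 A) (r : ℕ) :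
    ∃ (B : GeneralizedMNWA S) (η : B.State → S.Spheres r),
      B.language = Set.univ ∧
      ∀ (W : NestedWord S) (ρ : W.Node → B.State), B.IsAcceptingRun W ρ →
        ∀ i : W.Node, Nonempty ((η (ρ i)).1.Iso (W.sphere r i)) := by
  obtain ⟨N, V, o, hV⟩ := S.exists_sphere_representatives r
  let D : SphereFamily S := ⟨r, 5 ^ (2 * r + 1) + 1, N, V, o⟩
  refine ⟨D.automaton, fun q => ⟨D.sphere q.type, V q.type, o q.type,
    ⟨⟨Equiv.refl _, fun _ _ => Iff.rfl, fun _ _ => Iff.rfl, fun _ => rfl, rfl⟩⟩⟩, ?_, ?_⟩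
  · refine Set.eq_univ_of_forall fun W => ?_
    obtain ⟨χ, hχ⟩ := W.exists_coloring (2 * r + 1)
    obtain ⟨ρ, hρ⟩ := SphereFamily.exists_isConsistent (D := D) χ hχ (hV W)
    exact ⟨ρ, SphereFamily.isAcceptingRun_iff.mpr hρ⟩
  · intro W ρ hρ i
    have h := SphereFamily.isAcceptingRun_iff.mp hρ
    refine NestedWord.nonempty_iso_of_isPartialCover
      (h.isPartialCover (ρ i).color (ρ i).type) (h.fits i).center ?_
    intro e j k x n hj hn hnr hs
    obtain ⟨b, hb⟩ := (h.extends_of_step hs).interior hj ⟨n, hnr, hn⟩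
    obtain ⟨l, y, z, hy, rfl, -⟩ := (h.extends_of_step hs).step hj hb
    obtain rfl := congrArg Sigma.fst hy
    exact ⟨z, hb⟩
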